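/- Let $(A,\mathfrak m,k)$ be a commutative Noetherian local ring; all modules are finitely generated $A$-modules. For a module $X$ with minimal free resolution $\cdots\to F_1\to F_0\to X\to 0$, let $\beta_n(X)=\operatorname{rank}F_n$ and let $\Omega^n(X)$ be the $n$th syzygy in this resolution, with $\Omega^0(X)=X$. The complexity of $X$ is $$\operatorname{cx}X=\inf\{s\in\mathbb Z_{\ge 0}\mid \exists\, a\in\mathbb R:\ \beta_n(X)\le a\,n^{s-1}\text{ for all } n\gg 0\}\in\mathbb Z_{\ge 0}\cup\{\infty\}.$$ For $n\ge 1$ and $\eta\in\operatorname{Ext}^n_A(X,X)$ represented by a map $f:\Omega^n(X)\to X$, let $K_\eta$ be the pushout of $f$ and the inclusion $\Omega^n(X)\hookrightarrow F_{n-1}$, so that there is an exact sequence $0\to X\to K_\eta\to\Omega^{n-1}(X)\to 0$; up to isomorphism, $K_\eta$ does not depend on the choice of $f$. The class $\mathcal C_A^{frc}$ of modules of free reducible complexity is defined inductively: (i) every module of finite projective dimension belongs to $\mathcal C_A^{frc}$; (ii) a module $X$ with $0<\operatorname{cx}X<\infty$ belongs to $\mathcal C_A^{frc}$ if there are $n\ge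 1$ and $\eta\in\operatorname{Ext}_A^n(X,X)$ such that $\operatorname{cx}K_\eta=\operatorname{cx}X-1$ and $K_\eta\in\mathcal C_A^{frc}$. Theorem. Let $M\in\mathcal C_A^{frc}$ and let $t\ge 1$ be an integer. Suppose that for every $N\in\mathcal C_A^{frc}$ with $\operatorname{cx}N=t$ there is an integer $i_0$ (which may depend on $N$) such that $\operatorname{Ext}_A^i(M,N)=0$ for all $i\ge i_0$. Then $\operatorname{cx}M<t$. -/

import Mathlib

open CategoryTheory CategoryTheory.Abelian Filter

universe u

namespace FreeReducible

variable {A : Type u} [CommRing A] [IsLocalRing A]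

/-- Every finitely generated module over a local ring has a minimal free cover: a surjection from
a free module `A^b` whose kernel lies in `𝔪 A^b`. -/
theorem exists_minimalCover (M : FGModuleCat.{u} A) :
    ∃ b : ℕ, ∃ p : (Fin b → A) →ₗ[A] M, Function.Surjective p ∧
      ∀ x : Fin b → A, p x = 0 → ∀ i, x i ∈ IsLocalRing.maximalIdeal A := by
  let k := IsLocalRing.ResidueField A
  let B := Module.finBasis k (TensorProduct A k M)
  have hs : Function.Surjective (TensorProduct.mk A k M 1) :=
    TensorProduct.mk_surjective A M k Ideal.Quotient.mk_surjective
  choose v hv using fun i => hs (B i)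
  refine ⟨_, Fintype.linearCombination A v, ?_, ?_⟩
  · rw [← LinearMap.range_eq_top, Fintype.range_linearCombination]
    exact IsLocalRing.span_eq_top_of_tmul_eq_basis v B hv
  · intro x hx i
    have h0 : ∑ j, IsLocalRing.residue A (x j) • B j = 0 := by
      have h := congrArg (TensorProduct.mk A k M 1) hx
      rw [Fintype.linearCombination_apply, map_sum, map_zero] at h
      rw [← h]
      refine Finset.sum_congr rfl fun j _ => ?_
      rw [map_smul, hv]
      exact algebraMap_smul k (x j) (B j)
    have h1 := Fintype.linearIndependent_iff.1 B.linearIndependent _ h0 i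
    exact (IsLocalRing.residue_eq_zero_iff _).1 h1

/-- The rank of the free module in a minimal free cover of `M`. -/
noncomputable def coverRank (M : FGModuleCat.{u} A) : ℕ :=
  (exists_minimalCover M).choose

/-- A minimal free cover `A^b → M`. -/
noncomputable def coverMap (M : FGModuleCat.{u} A) : (Fin (coverRank M) → A) →ₗ[A] M :=
  (exists_minimalCover M).choose_spec.choose

theorem coverMap_surjective (M : FGModuleCat.{u} A) : Function.Surjective (coverMap M) :=
  (exists_minimalCover M).choose_spec.choose_spec.1

variable [IsNoetherianRing A]

/-- The first syzygy `Ω(M)`: the kernel of the minimal free cover of `M`. -/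
noncomputable def syzygyOne (M : FGModuleCat.{u} A) : FGModuleCat.{u} A :=
  FGModuleCat.of A (LinearMap.ker (coverMap M))

/-- The `n`th syzygy `Ωⁿ(M)` in the minimal free resolution of `M`, with `Ω⁰(M) = M`. The minimal
free resolution itself is obtained by splicing the minimal free covers of the syzygies. -/
noncomputable def syzygy (M : FGModuleCat.{u} A) : ℕ → FGModuleCat.{u} A
  | 0 => M
  | n + 1 => syzygyOne (syzygy M n)

/-- The `n`th Betti number: the rank of the `n`th module in the minimal free resolution of `M`. -/
noncomputable def betti (M : FGModuleCat.{u} A) (n : ℕ) : ℕ :=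
  coverRank (syzygy M n)

/-- The complexity of `M`: the infimum, in `ℕ ∪ {∞}`, of all `t ≥ 0` such that
`β_n(M) ≤ a n^(t-1)` for some real `a` and all large `n` (for `t = 0` the exponent is `-1`). -/
noncomputable def complexity (M : FGModuleCat.{u} A) : ℕ∞ :=
  sInf {c : ℕ∞ | ∃ t : ℕ, c = (t : ℕ∞) ∧
    ∃ a : ℝ, ∀ᶠ n : ℕ in atTop, (betti M n : ℝ) ≤ a * (n : ℝ) ^ ((t : ℤ) - 1)}

/-- The sequence `0 → Ω(M) → F₀ → M → 0` given by the minimal free cover. -/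
noncomputable def coverSequence (M : FGModuleCat.{u} A) : ShortComplex (ModuleCat.{u} A) :=
  ShortComplex.mk (X₁ := (syzygyOne M).obj) (X₂ := ModuleCat.of A (Fin (coverRank M) → A))
    (X₃ := M.obj) (ModuleCat.ofHom (LinearMap.ker (coverMap M)).subtype)
    (ModuleCat.ofHom (coverMap M)) (by ext x; exact x.2)

theorem coverSequence_shortExact (M : FGModuleCat.{u} A) : (coverSequence M).ShortExact where
  exact := by
    rw [ShortComplex.moduleCat_exact_iff]
    intro x hx
    exact ⟨⟨x, hx⟩, rfl⟩
  mono_f := (ModuleCat.mono_iff_injective _).2 Subtype.val_injective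
  epi_g := (ModuleCat.epi_iff_surjective _).2 (coverMap_surjective M)

/-- The class in `Extⁿ(M, Ωⁿ(M))` of the exact sequence
`0 → Ωⁿ(M) → F_{n-1} → ⋯ → F₀ → M → 0` cut out of the minimal free resolution of `M`. -/
noncomputable def syzygyClass (M : FGModuleCat.{u} A) :
    (n : ℕ) → Ext.{u} M.obj (syzygy M n).obj n
  | 0 => Ext.mk₀ (𝟙 M.obj)
  | n + 1 => (syzygyClass M n).comp (coverSequence_shortExact (syzygy M n)).extClass rfl

/-- The map `f : Ωⁿ(M) → N` represents `η ∈ Extⁿ(M, N)`. -/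
def Represents {M N : FGModuleCat.{u} A} {n : ℕ} (f : syzygy M n →ₗ[A] N)
    (η : Ext.{u} M.obj N.obj n) : Prop :=
  (syzygyClass M n).comp (Ext.mk₀ (ModuleCat.ofHom f)) (add_zero n) = η

theorem exists_syzygyClass_comp (M N : FGModuleCat.{u} A) (n : ℕ) :
    ∀ (m l : ℕ) (h : n + m = l) (η : Ext.{u} M.obj N.obj l),
      ∃ ξ : Ext.{u} (syzygy M n).obj N.obj m, (syzygyClass M n).comp ξ h = η := by
  induction n with
  | zero =>
    intro m l h η
    obtain rfl : m = l := by omega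
    exact ⟨η, Ext.mk₀_id_comp η⟩
  | succ n ih =>
    intro m l h η
    obtain ⟨ξ, rfl⟩ := ih (1 + m) l (by omega) η
    have hP : Projective (coverSequence (syzygy M n)).X₂ :=
      (IsProjective.iff_projective (Fin (coverRank (syzygy M n)) → A)).1 inferInstance
    have h0 : (Ext.mk₀ (coverSequence (syzygy M n)).g).comp ξ (zero_add (1 + m)) = 0 := by
      obtain ⟨j, hj⟩ : ∃ j, 1 + m = j + 1 := ⟨m, add_comm 1 m⟩
      generalize 1 + m = r at ξ hj
      subst hj
      exact Ext.eq_zero_of_projective _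
    obtain ⟨ζ, rfl⟩ := Ext.contravariant_sequence_exact₃
      (coverSequence_shortExact (syzygy M n)) N.obj ξ h0 rfl
    exact ⟨ζ, Ext.comp_assoc _ _ _ rfl rfl (by omega)⟩

/-- Every class in `Extⁿ(M, N)` is represented by some map `Ωⁿ(M) → N`. -/
theorem exists_represents {M N : FGModuleCat.{u} A} {n : ℕ} (η : Ext.{u} M.obj N.obj n) :
    ∃ f : syzygy M n →ₗ[A] N, Represents f η := by
  obtain ⟨ξ, hξ⟩ := exists_syzygyClass_comp M N n 0 n (add_zero n) η
  obtain ⟨f, rfl⟩ := Ext.mk₀_bijective _ _ |>.2 ξ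
  exact ⟨f.hom, hξ⟩

/-- The pushout of `N ← Ωⁿ⁺¹(M) → F_n` along `f` and the inclusion, as a quotient of
`N × F_n`. -/
noncomputable def pushoutModule {M N : FGModuleCat.{u} A} {n : ℕ}
    (f : syzygy M (n + 1) →ₗ[A] N) : FGModuleCat.{u} A :=
  let ι : syzygy M (n + 1) →ₗ[A] (Fin (coverRank (syzygy M n)) → A) :=
    (LinearMap.ker (coverMap (syzygy M n))).subtype
  FGModuleCat.of A ((N × (Fin (coverRank (syzygy M n)) → A)) ⧸ LinearMap.range (f.prod (-ι)))

/-- The module `K_η` attached to `η ∈ Extⁿ⁺¹(M, N)`: the pushout along a map `Ωⁿ⁺¹(M) → N`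
representing `η`. Up to isomorphism it does not depend on the representative. -/
noncomputable def extModule {M N : FGModuleCat.{u} A} {n : ℕ}
    (η : Ext.{u} M.obj N.obj (n + 1)) : FGModuleCat.{u} A :=
  pushoutModule (exists_represents η).choose

/-- Modules of free reducible complexity: (i) every module of finite projective dimension, and
(ii) every module `X` of positive finite complexity with a class `η ∈ Extⁿ⁺¹(X, X)`, for some
`n ≥ 0`, such that `cx K_η = cx X - 1` and `K_η` has free reducible complexity. -/
inductive HasFreeReducibleComplexity : FGModuleCat.{u} A → Prop
  | of_finite_projectiveDimension (X : FGModuleCat.{u} A)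
      (h : ∃ d : ℕ, HasProjectiveDimensionLE X.obj d) : HasFreeReducibleComplexity X
  | of_reducing (X : FGModuleCat.{u} A) (hpos : 0 < complexity X) (hfin : complexity X < ⊤)
      (n : ℕ) (η : Ext.{u} X.obj X.obj (n + 1))
      (hcx : complexity (extModule η) + 1 = complexity X)
      (hK : HasFreeReducibleComplexity (extModule η)) : HasFreeReducibleComplexity X

end FreeReducible

/-!
Suppose `cx M ≥ t`. Reducing the complexity of `M` one step at a time leads to a module `N` of
free reducible complexity with `cx N = t` exactly (`exists_complexity_eq_of_le`). Every step
replaces `X` by an extension `K_η` of a syzygy of `X` by `X`, so if `Ext^i(X, Y) = 0` for all large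
`i`, then also `Ext^i(K_η, Y) = 0` for all large `i`. Applied to `Y = N`, the hypothesis on `M`
therefore gives `Ext^i(N, N) = 0` for all large `i`.

As `t > 0`, the module `N` has infinite projective dimension, so some `η ∈ Ext^(n+1)(N, N)` has
`cx K_η = cx N - 1`. Some power `η^m` lies in a vanishing `Ext` group, so `η` is nilpotent. Let `k`
be the residue field. By the long exact sequence of `0 → N → K_η → Ωⁿ(N) → 0`, the kernel of
multiplication by `η` on `Ext^i(N, k)` is contained in the image of `Ext^i(K_η, k)`, whose length
is at most `β_i(K_η)` (`length_ker_precomp_le`). Filtering `Ext^i(N, k)` by the kernels of the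
powers of `η` gives
`β_i(N) ≤ ∑_{j < m} β_{i + j(n+1)}(K_η)` (`betti_le_sum_of_extPow_eq_zero`).
Hence `cx N ≤ cx K_η`, which is a contradiction.

Dimensions over `k` are measured as lengths over `A`, which are additive without any choice of a
`k`-structure on the `Ext` groups.
-/

namespace FreeReducible

variable {A : Type u} [CommRing A] [IsLocalRing A]

/-! ### Minimal covers and maps to the residue field -/

theorem mem_maximalIdeal_of_coverMap_eq_zero (M : FGModuleCat.{u} A) {x : Fin (coverRank M) → A}
    (hx : coverMap M x = 0) (i : Fin (coverRank M)) : x i ∈ IsLocalRing.maximalIdeal A :=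
  (exists_minimalCover M).choose_spec.choose_spec.2 x hx i

variable (A) in
/-- The residue field of `A`, as an object of `ModuleCat A`. -/
noncomputable abbrev residueModule : ModuleCat.{u} A :=
  ModuleCat.of A (IsLocalRing.ResidueField A)

theorem residueField_smul_eq_zero {a : A} (ha : a ∈ IsLocalRing.maximalIdeal A)
    (y : IsLocalRing.ResidueField A) : a • y = 0 := by
  rw [Algebra.smul_def, IsLocalRing.ResidueField.algebraMap_eq,
    (IsLocalRing.residue_eq_zero_iff a).2 ha, zero_mul]

/-- Minimality of the cover: maps to the residue field kill the syzygy. -/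
theorem ker_coverMap_le_ker (M : FGModuleCat.{u} A)
    (g : (Fin (coverRank M) → A) →ₗ[A] IsLocalRing.ResidueField A) :
    LinearMap.ker (coverMap M) ≤ LinearMap.ker g := by
  intro x hx
  rw [LinearMap.mem_ker, LinearMap.pi_apply_eq_sum_univ g x]
  exact Finset.sum_eq_zero fun i _ =>
    residueField_smul_eq_zero (mem_maximalIdeal_of_coverMap_eq_zero M hx i) _

/-- By minimality, a map `M → k` is the same as a map from the minimal cover of `M` to `k`. -/
theorem length_linearMap_residueField (M : FGModuleCat.{u} A) :
    Module.length A (M →ₗ[A] IsLocalRing.ResidueField A) = coverRank M := by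
  let k := IsLocalRing.ResidueField A
  have hbij : Function.Bijective (LinearMap.lcomp A k (coverMap M)) := by
    refine ⟨fun g h hgh => ?_, fun g => ?_⟩
    · ext x
      obtain ⟨y, rfl⟩ := coverMap_surjective M x
      exact LinearMap.congr_fun hgh y
    · refine ⟨(LinearMap.ker (coverMap M)).liftQ g (ker_coverMap_le_ker M g) ∘ₗ
        ((coverMap M).quotKerEquivOfSurjective (coverMap_surjective M)).symm.toLinearMap, ?_⟩
      ext1 i
      ext
      simp only [LinearMap.lcomp_apply', LinearMap.comp_apply, LinearEquiv.coe_coe]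
      rw [← LinearMap.quotKerEquivOfSurjective_apply_mk (coverMap M) (coverMap_surjective M),
        LinearEquiv.symm_apply_apply]
      simp
  have : IsSimpleModule A k := by
    have : IsSimpleModule A (A ⧸ IsLocalRing.maximalIdeal A) :=
      isSimpleModule_iff_isCoatom.2 (IsLocalRing.maximalIdeal.isMaximal A).out
    exact this
  rw [(LinearEquiv.ofBijective _ hbij).length_eq,
    ← ((Pi.basisFun A (Fin (coverRank M))).constr A).length_eq, Module.length_pi_of_fintype]
  simp

variable [IsNoetherianRing A]

/-! ### Dimension shifting along the minimal resolution -/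

theorem projective_coverSequence (M : FGModuleCat.{u} A) : Projective (coverSequence M).X₂ :=
  (IsProjective.iff_projective (Fin (coverRank M) → A)).1 inferInstance

/-- Connecting maps of the cover sequence are injective in positive degrees, since `Ext` of a free
module vanishes there. -/
theorem coverClass_comp_eq_zero (M : FGModuleCat.{u} A) (Y : ModuleCat.{u} A) {m l : ℕ}
    (h : 1 + (m + 1) = l) (ξ : Ext.{u} (syzygyOne M).obj Y (m + 1))
    (hξ : (coverSequence_shortExact M).extClass.comp ξ h = 0) : ξ = 0 := by
  obtain ⟨ζ, rfl⟩ := Ext.contravariant_sequence_exact₁ (coverSequence_shortExact M) Y ξ h hξ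
  have := projective_coverSequence M
  rw [Ext.eq_zero_of_projective ζ]
  exact Ext.comp_zero _ _ _ _ _

/-- For maps into the residue field the connecting map is injective in degree zero as well, by
minimality of the cover. -/
theorem coverClass_comp_eq_zero_of_residueField (M : FGModuleCat.{u} A)
    (ξ : Ext.{u} (syzygyOne M).obj (residueModule A) 0)
    (hξ : (coverSequence_shortExact M).extClass.comp ξ (add_zero 1) = 0) : ξ = 0 := by
  obtain ⟨ζ, rfl⟩ :=
    Ext.contravariant_sequence_exact₁ (coverSequence_shortExact M) _ ξ (add_zero 1) hξ
  obtain ⟨g, rfl⟩ := (Ext.mk₀_bijective _ _).2 ζ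
  have h0 : (coverSequence M).f ≫ g = 0 := by
    ext x
    exact ker_coverMap_le_ker M g.hom x.2
  exact (Ext.mk₀_comp_mk₀ _ _).trans ((congrArg Ext.mk₀ h0).trans (Ext.mk₀_zero _ _))

theorem syzygyClass_comp_eq_zero (M : FGModuleCat.{u} A) (Y : ModuleCat.{u} A) (n : ℕ) :
    ∀ {m l : ℕ} (h : n + (m + 1) = l) (ξ : Ext.{u} (syzygy M n).obj Y (m + 1)),
      (syzygyClass M n).comp ξ h = 0 → ξ = 0 := by
  induction n with
  | zero =>
    intro m l h ξ hξ
    obtain rfl : m + 1 = l := by omega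
    exact (Ext.mk₀_id_comp ξ).symm.trans hξ
  | succ n ih =>
    intro m l h ξ hξ
    refine coverClass_comp_eq_zero (syzygy M n) Y (add_comm 1 (m + 1)) ξ
      (ih (m := m + 1) (l := l) (by omega) _ ?_)
    exact (Ext.comp_assoc _ _ _ rfl _ (by omega)).symm.trans hξ

theorem syzygyClass_comp_eq_zero_of_residueField (M : FGModuleCat.{u} A) (n : ℕ)
    (ξ : Ext.{u} (syzygy M n).obj (residueModule A) 0)
    (hξ : (syzygyClass M n).comp ξ (add_zero n) = 0) : ξ = 0 := by
  cases n with
  | zero => exact (Ext.mk₀_id_comp ξ).symm.trans hξ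
  | succ n =>
    refine coverClass_comp_eq_zero_of_residueField (syzygy M n) ξ
      (syzygyClass_comp_eq_zero M _ n (m := 0) rfl _ ?_)
    exact (Ext.comp_assoc _ _ _ rfl _ (by omega)).symm.trans hξ

/-- Betti numbers are read off from `Ext` into the residue field. -/
theorem length_ext_residueField (M : FGModuleCat.{u} A) (n : ℕ) :
    Module.length A (Ext.{u} M.obj (residueModule A) n) = betti M n := by
  have hbij : Function.Bijective
      ((syzygyClass M n).precompOfLinear A (residueModule A) (add_zero n)) := by
    refine ⟨(injective_iff_map_eq_zero _).2 (syzygyClass_comp_eq_zero_of_residueField M n), ?_⟩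
    exact exists_syzygyClass_comp M (FGModuleCat.of A (IsLocalRing.ResidueField A)) n 0 n
      (add_zero n)
  rw [← (LinearEquiv.ofBijective _ hbij).length_eq, (Ext.linearEquiv₀ (R := A)).length_eq,
    (ModuleCat.homLinearEquiv (S := A)).length_eq]
  exact length_linearMap_residueField (syzygy M n)

theorem subsingleton_ext_syzygy (M : FGModuleCat.{u} A) (Y : ModuleCat.{u} A) (n m : ℕ)
    (h : Subsingleton (Ext.{u} M.obj Y (n + (m + 1)))) :
    Subsingleton (Ext.{u} (syzygy M n).obj Y (m + 1)) :=
  subsingleton_of_forall_eq 0 fun ξ => syzygyClass_comp_eq_zero M Y n rfl ξ (h.elim _ _)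

/-! ### The pushout extension -/

/-- The exact sequence `0 → N → K → Ωⁿ(M) → 0`, where `K` is the pushout along
`f : Ωⁿ⁺¹(M) → N`. -/
noncomputable def pushoutSequence {M N : FGModuleCat.{u} A} {n : ℕ}
    (f : syzygy M (n + 1) →ₗ[A] N) : ShortComplex (ModuleCat.{u} A) :=
  ShortComplex.mk (X₁ := N.obj) (X₂ := (pushoutModule f).obj) (X₃ := (syzygy M n).obj)
    (ModuleCat.ofHom (Submodule.mkQ _ ∘ₗ LinearMap.inl A N (Fin (coverRank (syzygy M n)) → A)))
    (ModuleCat.ofHom (Submodule.liftQ _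
      (coverMap (syzygy M n) ∘ₗ LinearMap.snd A N (Fin (coverRank (syzygy M n)) → A)) (by
        rintro _ ⟨z, rfl⟩
        have hz : coverMap (syzygy M n) z.1 = 0 := z.2
        change coverMap (syzygy M n) (-z.1) = 0
        rw [map_neg, hz, neg_zero])))
    (by
      ext x
      exact map_zero (coverMap (syzygy M n)))

theorem pushoutSequence_shortExact {M N : FGModuleCat.{u} A} {n : ℕ}
    (f : syzygy M (n + 1) →ₗ[A] N) : (pushoutSequence f).ShortExact where
  exact := by
    rw [ShortComplex.moduleCat_exact_iff]
    intro x hx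
    obtain ⟨⟨a, y⟩, rfl⟩ := Submodule.mkQ_surjective _ x
    let z : syzygy M (n + 1) := ⟨y, hx⟩
    refine ⟨a + f z, (Submodule.Quotient.eq _).2 ⟨z, ?_⟩⟩
    change (f z, -y) = (a + f z - a, 0 - y)
    rw [add_sub_cancel_left, zero_sub]
  mono_f := by
    refine (ModuleCat.mono_iff_injective _).2 ((injective_iff_map_eq_zero _).2 fun x hx => ?_)
    obtain ⟨z, hz⟩ := (Submodule.Quotient.mk_eq_zero _).1 hx
    obtain ⟨h1, h2⟩ := Prod.mk.inj hz
    have hz0 : z = 0 := Subtype.ext (neg_eq_zero.1 h2)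
    rw [hz0, map_zero] at h1
    exact h1.symm
  epi_g := by
    refine (ModuleCat.epi_iff_surjective _).2 fun x => ?_
    obtain ⟨y, rfl⟩ := coverMap_surjective (syzygy M n) x
    exact ⟨Submodule.Quotient.mk (0, y), rfl⟩

/-- The morphism of exact sequences exhibiting `pushoutModule f` as a pushout. -/
noncomputable def coverToPushout {M N : FGModuleCat.{u} A} {n : ℕ}
    (f : syzygy M (n + 1) →ₗ[A] N) : coverSequence (syzygy M n) ⟶ pushoutSequence f where
  τ₁ := ModuleCat.ofHom f
  τ₂ := ModuleCat.ofHom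
    (Submodule.mkQ _ ∘ₗ LinearMap.inr A N (Fin (coverRank (syzygy M n)) → A))
  τ₃ := 𝟙 _
  comm₁₂ := by
    ext z
    refine (Submodule.Quotient.eq _).2 ⟨z, ?_⟩
    change (f z, -z.1) = (f z - 0, 0 - z.1)
    rw [sub_zero, zero_sub]
  comm₂₃ := by
    ext y
    rfl

/-- Splicing the pushout extension with the minimal resolution of `M` gives back `η`. -/
theorem syzygyClass_comp_pushoutClass {M N : FGModuleCat.{u} A} {n : ℕ}
    {f : syzygy M (n + 1) →ₗ[A] N} {η : Ext.{u} M.obj N.obj (n + 1)} (hf : Represents f η) :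
    (syzygyClass M n).comp (pushoutSequence_shortExact f).extClass rfl = η := by
  have h := ShortComplex.ShortExact.extClass_naturality (coverSequence_shortExact (syzygy M n))
    (pushoutSequence_shortExact f) (coverToPushout f)
  have h' : (coverSequence_shortExact (syzygy M n)).extClass.comp
      (Ext.mk₀ (ModuleCat.ofHom f)) (add_zero 1) = (pushoutSequence_shortExact f).extClass :=
    h.trans (Ext.mk₀_id_comp _)
  rw [← hf, ← h']
  exact (Ext.comp_assoc _ _ _ rfl _ (by omega)).symm

/-- The exact sequence `0 → N → K_η → Ωⁿ(M) → 0`, with its relation to `η`. -/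
theorem exists_extModule_sequence {M N : FGModuleCat.{u} A} {n : ℕ}
    (η : Ext.{u} M.obj N.obj (n + 1)) :
    ∃ (i : N.obj ⟶ (extModule η).obj) (p : (extModule η).obj ⟶ (syzygy M n).obj) (w : i ≫ p = 0)
      (hS : (ShortComplex.mk i p w).ShortExact),
      (syzygyClass M n).comp hS.extClass rfl = η :=
  ⟨_, _, _, pushoutSequence_shortExact _,
    syzygyClass_comp_pushoutClass (exists_represents η).choose_spec⟩

theorem subsingleton_ext_extModule {M : FGModuleCat.{u} A} {n m : ℕ}
    (η : Ext.{u} M.obj M.obj (n + 1)) (Y : ModuleCat.{u} A)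
    (h₁ : Subsingleton (Ext.{u} M.obj Y (m + 1)))
    (h₂ : Subsingleton (Ext.{u} M.obj Y (n + (m + 1)))) :
    Subsingleton (Ext.{u} (extModule η).obj Y (m + 1)) := by
  obtain ⟨i, p, w, hS, -⟩ := exists_extModule_sequence η
  have := subsingleton_ext_syzygy M Y n m h₂
  refine subsingleton_of_forall_eq 0 fun x => ?_
  obtain ⟨y, rfl⟩ := Ext.contravariant_sequence_exact₂ hS Y x (h₁.elim _ _)
  rw [this.elim y 0, Ext.comp_zero]

/-- A class killed by `η` lifts to `K_η`, so the kernel of multiplication by `η` is bounded by the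
Betti numbers of `K_η`. -/
theorem length_ker_precomp_le {M : FGModuleCat.{u} A} {n : ℕ} (η : Ext.{u} M.obj M.obj (n + 1))
    {i l : ℕ} (h : n + 1 + i = l) :
    Module.length A (LinearMap.ker (η.precompOfLinear A (residueModule A) h)) ≤
      betti (extModule η) i := by
  obtain ⟨j, p, w, hS, hη⟩ := exists_extModule_sequence η
  rw [← length_ext_residueField]
  let r := (Ext.mk₀ j).precompOfLinear A (residueModule A) (zero_add i)
  have hle : LinearMap.ker (η.precompOfLinear A (residueModule A) h) ≤ LinearMap.range r := by
    intro x hx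
    have hx' : η.comp x h = 0 := hx
    refine Ext.contravariant_sequence_exact₁ hS _ x (add_comm 1 i)
      (syzygyClass_comp_eq_zero M _ n (l := l) (by omega) _ ?_)
    rw [← hη] at hx'
    exact (Ext.comp_assoc _ _ _ rfl _ (by omega)).symm.trans hx'
  exact (Module.length_le_of_injective _ (Submodule.inclusion_injective hle)).trans
    (Module.length_le_of_surjective _ r.surjective_rangeRestrict)

/-! ### Nilpotent self-extensions -/

/-- The `m`th power of `η ∈ Extᵈ(X, X)` in the Yoneda algebra of `X`. The zeroth power is the
identity, written as a composite with itself to land in degree `0 * d`. -/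
noncomputable def extPow {X : ModuleCat.{u} A} {d : ℕ} (η : Ext.{u} X X d) :
    (m : ℕ) → Ext.{u} X X (m * d)
  | 0 => (Ext.mk₀ (𝟙 X)).comp (Ext.mk₀ (𝟙 X)) (by omega)
  | m + 1 => (extPow η m).comp η (Nat.succ_mul m d).symm

theorem length_ker_le_add {R V W U : Type*} [CommRing R] [AddCommGroup V] [AddCommGroup W]
    [AddCommGroup U] [Module R V] [Module R W] [Module R U] (g : W →ₗ[R] U) (f : V →ₗ[R] W) :
    Module.length R (LinearMap.ker (g ∘ₗ f)) ≤
      Module.length R (LinearMap.ker f) + Module.length R (LinearMap.ker g) := by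
  let f' : LinearMap.ker (g ∘ₗ f) →ₗ[R] LinearMap.ker g := f.restrict fun _ hx => hx
  let i := Submodule.inclusion (LinearMap.ker_le_ker_comp f g)
  have hex : Function.Exact i f'.rangeRestrict := by
    intro x
    constructor
    · intro hx
      have : f x = 0 := congrArg (fun y => (y.1 : LinearMap.ker g).1) hx
      exact ⟨⟨x, this⟩, rfl⟩
    · rintro ⟨y, rfl⟩
      exact Subtype.ext (Subtype.ext y.2)
  rw [Module.length_eq_add_of_exact i f'.rangeRestrict (Submodule.inclusion_injective _)
    f'.surjective_rangeRestrict hex]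
  gcongr
  exact Module.length_le_of_injective _ (LinearMap.range f').injective_subtype

/-- The kernel of `η ^ (m + 1)` on `Ext^i(M, k)` is an extension of a submodule of the kernel of
`η ^ m` on `Ext^(i + n + 1)(M, k)` by the kernel of `η`. -/
theorem length_ker_extPow_le {M : FGModuleCat.{u} A} {n : ℕ} (η : Ext.{u} M.obj M.obj (n + 1))
    (m : ℕ) : ∀ {i l : ℕ} (h : m * (n + 1) + i = l),
      Module.length A (LinearMap.ker ((extPow η m).precompOfLinear A (residueModule A) h)) ≤
        ∑ j ∈ Finset.range m, (betti (extModule η) (i + j * (n + 1)) : ℕ∞) := by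
  induction m with
  | zero =>
    intro i l h
    obtain rfl : i = l := by omega
    have : LinearMap.ker ((extPow η 0).precompOfLinear A (residueModule A) h) = ⊥ := by
      rw [LinearMap.ker_eq_bot']
      intro x hx
      have hx' : (extPow η 0).comp x h = 0 := hx
      rwa [extPow, Ext.comp_assoc _ _ _ _ (zero_add i) (by omega), Ext.mk₀_id_comp,
        Ext.mk₀_id_comp] at hx'
    rw [this, Module.length_bot]
    exact zero_le
  | succ m ih =>
    intro i l h
    have hl : m * (n + 1) + (n + 1 + i) = l := by rw [← h]; ring
    have hcomp : (extPow η (m + 1)).precompOfLinear A (residueModule A) h =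
        (extPow η m).precompOfLinear A (residueModule A) hl ∘ₗ
          η.precompOfLinear A (residueModule A) rfl := by
      ext1 x
      exact Ext.comp_assoc _ _ _ _ rfl (by omega)
    rw [hcomp, Finset.sum_range_succ']
    refine (length_ker_le_add _ _).trans ((add_comm _ _).trans_le (add_le_add ?_ ?_))
    · refine (ih hl).trans_eq (Finset.sum_congr rfl fun j _ => ?_)
      rw [show n + 1 + i + j * (n + 1) = i + (j + 1) * (n + 1) by ring]
    · simpa using length_ker_precomp_le η rfl

/-- If `η ^ m = 0`, the kernel of `η ^ m` on `Ext^i(M, k)` is everything. -/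
theorem betti_le_sum_of_extPow_eq_zero {M : FGModuleCat.{u} A} {n : ℕ}
    (η : Ext.{u} M.obj M.obj (n + 1)) {m : ℕ} (hm : extPow η m = 0) (i : ℕ) :
    betti M i ≤ ∑ j ∈ Finset.range m, betti (extModule η) (i + j * (n + 1)) := by
  have h := length_ker_extPow_le η m (i := i) rfl
  rw [hm, show (0 : Ext.{u} M.obj M.obj (m * (n + 1))).precompOfLinear A (residueModule A)
      (rfl : m * (n + 1) + i = _) = 0 from map_zero _, LinearMap.ker_zero, Module.length_top,
    length_ext_residueField] at h
  exact_mod_cast h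

/-! ### Growth of Betti numbers -/

theorem complexity_le_of_betti_le {M : FGModuleCat.{u} A} {t : ℕ} {a : ℝ}
    (h : ∀ᶠ n : ℕ in atTop, (betti M n : ℝ) ≤ a * (n : ℝ) ^ ((t : ℤ) - 1)) :
    complexity M ≤ t :=
  sInf_le ⟨t, rfl, a, h⟩

theorem exists_betti_le_of_complexity_eq {M : FGModuleCat.{u} A} {t : ℕ}
    (h : complexity M = t) :
    ∃ a : ℝ, ∀ᶠ n : ℕ in atTop, (betti M n : ℝ) ≤ a * (n : ℝ) ^ ((t : ℤ) - 1) := by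
  -- The infimum of the empty set is `⊤`, so the defining set is nonempty and its infimum attained.
  have hne : {c : ℕ∞ | ∃ t : ℕ, c = (t : ℕ∞) ∧ ∃ a : ℝ,
      ∀ᶠ n : ℕ in atTop, (betti M n : ℝ) ≤ a * (n : ℝ) ^ ((t : ℤ) - 1)}.Nonempty := by
    rw [Set.nonempty_iff_ne_empty]
    intro he
    rw [complexity, he, sInf_empty] at h
    exact ENat.top_ne_natCast t h
  obtain ⟨s, hs, hs'⟩ := csInf_mem hne
  obtain rfl : s = t := by exact_mod_cast hs.symm.trans h
  exact hs'

theorem complexity_eq_zero_of_hasProjectiveDimensionLE {M : FGModuleCat.{u} A} {d : ℕ}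
    (h : HasProjectiveDimensionLE M.obj d) : complexity M = 0 := by
  refine le_antisymm (complexity_le_of_betti_le (t := 0) (a := 0) ?_) bot_le
  filter_upwards [eventually_ge_atTop (d + 1)] with n hn
  have h0 := length_ext_residueField M n
  have := HasProjectiveDimensionLT.subsingleton M.obj (d + 1) n hn (residueModule A)
  rw [Module.length_eq_zero] at h0
  have h1 : betti M n = 0 := by exact_mod_cast h0.symm
  simp [h1]

/-- A shift of the argument costs only a constant factor in polynomial growth. The case `t = 0`
is included, where `x ↦ x⁻¹` is decreasing. -/
theorem shift_zpow_le (t d n : ℕ) (hn : 0 < n) :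
    ((n + d : ℕ) : ℝ) ^ ((t : ℤ) - 1) ≤ ((1 + d : ℕ) : ℝ) ^ t * (n : ℝ) ^ ((t : ℤ) - 1) := by
  have hn' : (0 : ℝ) < n := by exact_mod_cast hn
  have hnd : (0 : ℝ) < (n + d : ℕ) := by exact_mod_cast Nat.add_pos_left hn d
  have h1 : ((n + d : ℕ) : ℝ) ≤ (1 + d : ℕ) * n := by
    exact_mod_cast (by nlinarith : n + d ≤ (1 + d) * n)
  have h2 : (n : ℝ) ≤ (n + d : ℕ) := by exact_mod_cast Nat.le_add_right n d
  -- As `x ^ (t - 1) = x ^ t * x⁻¹`, the two factors are compared separately.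
  rw [zpow_sub_one₀ hnd.ne', zpow_sub_one₀ hn'.ne', zpow_natCast, zpow_natCast, ← mul_assoc,
    ← mul_pow]
  gcongr

theorem complexity_le_of_betti_le_sum {M K : FGModuleCat.{u} A} {m d t : ℕ}
    (hK : complexity K = t)
    (h : ∀ i, betti M i ≤ ∑ j ∈ Finset.range m, betti K (i + j * d)) :
    complexity M ≤ t := by
  obtain ⟨a, ha⟩ := exists_betti_le_of_complexity_eq hK
  obtain ⟨n₀, hn₀⟩ := eventually_atTop.1 ha
  refine complexity_le_of_betti_le
    (a := ∑ j ∈ Finset.range m, |a| * ((1 + j * d : ℕ) : ℝ) ^ t) ?_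
  filter_upwards [eventually_ge_atTop n₀, eventually_gt_atTop 0] with n hn hpos
  calc (betti M n : ℝ) ≤ ∑ j ∈ Finset.range m, (betti K (n + j * d) : ℝ) := by
        exact_mod_cast h n
    _ ≤ ∑ j ∈ Finset.range m,
          |a| * (((1 + j * d : ℕ) : ℝ) ^ t * (n : ℝ) ^ ((t : ℤ) - 1)) := by
        refine Finset.sum_le_sum fun j _ => (hn₀ _ (le_add_right hn)).trans ?_
        gcongr
        · exact le_abs_self a
        · exact shift_zpow_le t (j * d) n hpos
    _ = _ := by
        rw [Finset.sum_mul]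
        exact Finset.sum_congr rfl fun j _ => (mul_assoc _ _ _).symm

/-! ### Reduction to self-extensions -/

/-- Reducing the complexity one step at a time, a module `N` of complexity exactly `t` is reached.
Each step is an extension of `M` by one of its syzygies, so vanishing of `Ext` is inherited. -/
theorem exists_complexity_eq_of_le {M : FGModuleCat.{u} A} (hM : HasFreeReducibleComplexity M)
    {t : ℕ} (ht : 0 < t) (hle : (t : ℕ∞) ≤ complexity M) :
    ∃ N : FGModuleCat.{u} A, HasFreeReducibleComplexity N ∧ complexity N = t ∧
      ∀ Y : ModuleCat.{u} A, (∃ i₀ : ℕ, ∀ i, i₀ ≤ i → Subsingleton (Ext.{u} M.obj Y i)) →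
        ∃ i₀ : ℕ, ∀ i, i₀ ≤ i → Subsingleton (Ext.{u} N.obj Y i) := by
  induction hM with
  | of_finite_projectiveDimension X h =>
    obtain ⟨d, hd⟩ := h
    rw [complexity_eq_zero_of_hasProjectiveDimensionLE hd] at hle
    have : t ≤ 0 := by exact_mod_cast hle
    omega
  | of_reducing X hpos hfin n η hcx hK ih =>
    rcases hle.eq_or_lt with heq | hlt
    · exact ⟨X, .of_reducing X hpos hfin n η hcx hK, heq.symm, fun _ h => h⟩
    · obtain ⟨N, hN, hNt, hNY⟩ := ih (by rw [← hcx] at hlt; exact Order.le_of_lt_add_one hlt)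
      refine ⟨N, hN, hNt, fun Y ⟨i₀, hi₀⟩ => hNY Y ⟨i₀ + 1, fun i hi => ?_⟩⟩
      obtain ⟨m, rfl⟩ : ∃ m, i = m + 1 := ⟨i - 1, by omega⟩
      exact subsingleton_ext_extModule η Y (hi₀ _ (by omega)) (hi₀ _ (by omega))

/-- If the high self-extensions vanish, then every positive-degree class `η` is nilpotent, so
`K_η` cannot have smaller complexity. -/
theorem complexity_eq_zero_of_subsingleton_ext_self {N : FGModuleCat.{u} A}
    (hN : HasFreeReducibleComplexity N) {i₀ : ℕ}
    (h : ∀ i, i₀ ≤ i → Subsingleton (Ext.{u} N.obj N.obj i)) : complexity N = 0 := by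
  cases hN with
  | of_finite_projectiveDimension _ hd =>
    exact complexity_eq_zero_of_hasProjectiveDimensionLE hd.choose_spec
  | of_reducing _ hpos hfin n η hcx hK =>
    have hη : extPow η i₀ = 0 := (h _ (Nat.le_mul_of_pos_right i₀ n.succ_pos)).elim _ _
    have hKtop : complexity (extModule η) ≠ ⊤ := by
      intro htop
      rw [htop, top_add] at hcx
      exact hfin.ne hcx.symm
    obtain ⟨s, hs⟩ := ENat.ne_top_iff_exists.1 hKtop
    have hle := complexity_le_of_betti_le_sum hs.symm (betti_le_sum_of_extPow_eq_zero η hη)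
    rw [← hcx, ← hs] at hle
    have : s + 1 ≤ s := by exact_mod_cast hle
    omega

end FreeReducible

theorem mainTheorem1 {A : Type u} [CommRing A] [IsLocalRing A] [IsNoetherianRing A]
    (M : FGModuleCat.{u} A) (hM : FreeReducible.HasFreeReducibleComplexity M)
    (t : ℕ) (ht : 0 < t)
    (hExt : ∀ N : FGModuleCat.{u} A, FreeReducible.HasFreeReducibleComplexity N →
      FreeReducible.complexity N = (t : ℕ∞) →
        ∃ i₀ : ℕ, ∀ i : ℕ, i₀ ≤ i → Subsingleton (Ext.{u} M.obj N.obj i)) :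
    FreeReducible.complexity M < (t : ℕ∞) := by
  by_contra hlt
  obtain ⟨N, hN, hNt, hNY⟩ := FreeReducible.exists_complexity_eq_of_le hM ht (not_lt.1 hlt)
  obtain ⟨i₀, hi₀⟩ := hNY N.obj (hExt N hN hNt)
  have h0 := FreeReducible.complexity_eq_zero_of_subsingleton_ext_self hN hi₀
  rw [hNt] at h0
  have : t = 0 := by exact_mod_cast h0
  omega
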